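/- Let $N\ge 4$ be an integer, $0<\mu<N$, $\lambda\ge 0$, and let $\Omega\subset\mathbb R^N$ be a bounded domain (a nonempty connected open set). Put $2^*_\mu:=\frac{2N-\mu}{N-2}$ and, for $\varepsilon>0$, $p_\varepsilon:=2^*_\mu-\varepsilon$. Let $H^1_0(\Omega)$ be the closure of $C_c^\infty(\Omega)$ in $H^1(\Omega)$, and let $\mathcal D^{1,2}(\mathbb R^N)$ be the completion of $C_c^\infty(\mathbb R^N)$ with respect to the norm $\left(\int_{\mathbb R^N}|\nabla u|^2\,dx\right)^{1/2}$, regarded as a space of functions in $L^{2N/(N-2)}(\mathbb R^N)$. Write $u^+:=\max\{u,0\}$. Define $$I_\varepsilon(u):=\frac12\int_\Omega|\nabla u|^2\,dx+\frac\lambda2\int_\Omega u^2\,dx-\frac1{2p_\varepsilon}\int_\Omega\int_\Omega\frac{(u^+(x))^{p_\varepsilon}(u^+(y))^{p_\varepsilon}}{|x-y|^\mu}\,dx\,dy,\qquad u\in H^1_0(\Omega),$$ $$\mathcal N_\varepsilon:=\Big\{u\in H^1_0(\Omega)\setminus\{0\}:\ \int_\Omega\left(|\nabla u|^2+\lambda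 u^2\right)dx=\int_\Omega\int_\Omega\frac{(u^+(x))^{p_\varepsilon}(u^+(y))^{p_\varepsilon}}{|x-y|^\mu}\,dx\,dy\Big\},\qquad m_\varepsilon:=\inf_{\mathcal N_\varepsilon}I_\varepsilon,$$ and $$I_*(u):=\frac12\int_{\mathbb R^N}|\nabla u|^2\,dx-\frac1{2\cdot2^*_\mu}\int_{\mathbb R^N}\int_{\mathbb R^N}\frac{(u^+(x))^{2^*_\mu}(u^+(y))^{2^*_\mu}}{|x-y|^\mu}\,dx\,dy,\qquad u\in\mathcal D^{1,2}(\mathbb R^N),$$ $$\mathcal N_*:=\Big\{u\in\mathcal D^{1,2}(\mathbb R^N)\setminus\{0\}:\ \int_{\mathbb R^N}|\nabla u|^2\,dx=\int_{\mathbb R^N}\int_{\mathbb R^N}\frac{(u^+(x))^{2^*_\mu}(u^+(y))^{2^*_\mu}}{|x-y|^\mu}\,dx\,dy\Big\},\qquad m_*:=\inf_{\mathcal N_*}I_*.$$ Then $$\lim_{\varepsilon\to0^+}m_\varepsilon=m_*.$$ -/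

import Mathlib

open MeasureTheory Filter Topology TopologicalSpace
open scoped Distributions ENNReal

noncomputable section

namespace Choquard

/-- The Euclidean space `ℝ^N`. -/
abbrev Space (N : ℕ) : Type := EuclideanSpace ℝ (Fin N)

variable {N : ℕ}

/-- `G` is the weak (distributional) gradient of `u` in the open set `Ω`:
`∫_Ω u ∂_v φ = - ∫_Ω φ ⟨G, v⟩` for all test functions `φ ∈ C_c^∞(Ω)` and all directions `v`.
It is used only for `u`, `G` that are locally integrable on `Ω`. -/
def HasWeakGradient (Ω : Opens (Space N)) (u : Space N → ℝ) (G : Space N → Space N) : Prop :=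
  ∀ (φ : 𝓓(Ω, ℝ)) (v : Space N),
    ∫ x in (Ω : Set (Space N)), u x * fderiv ℝ φ x v =
      - ∫ x in (Ω : Set (Space N)), φ x * inner ℝ (G x) v

/-- The Sobolev space `H¹₀(Ω)`, the closure of `C_c^∞(Ω)` in `H¹(Ω)`. An element is given by
a function `u ∈ L²(Ω)` together with (a representative of) its weak gradient `∇u ∈ L²(Ω; ℝ^N)`,
such that some sequence of test functions converges to `u` in the norm of `H¹(Ω)`.
The values outside `Ω` are irrelevant. -/
structure H10 (Ω : Opens (Space N)) where
  /-- the function `u` -/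
  toFun : Space N → ℝ
  /-- its weak gradient `∇u` -/
  grad : Space N → Space N
  memLp_toFun : MemLp toFun 2 (volume.restrict (Ω : Set (Space N)))
  memLp_grad : MemLp grad 2 (volume.restrict (Ω : Set (Space N)))
  hasWeakGradient : HasWeakGradient Ω toFun grad
  exists_approx : ∃ φ : ℕ → 𝓓(Ω, ℝ),
    Tendsto (fun n => eLpNorm (fun x => φ n x - toFun x) 2
      (volume.restrict (Ω : Set (Space N)))) atTop (𝓝 0) ∧
    Tendsto (fun n => eLpNorm (fun x => gradient (φ n) x - grad x) 2
      (volume.restrict (Ω : Set (Space N)))) atTop (𝓝 0)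

/-- The critical Sobolev exponent `2* = 2N / (N - 2)`. -/
def sobolevExponent (N : ℕ) : ℝ≥0∞ := ENNReal.ofReal (2 * (N : ℝ) / ((N : ℝ) - 2))

/-- The space `D^{1,2}(ℝ^N)` (for `N ≥ 3`), the completion of `C_c^∞(ℝ^N)` for the norm
`(∫ |∇u|²)^{1/2}`, realized as usual as a space of functions by means of the Sobolev embedding
`D^{1,2}(ℝ^N) ⊆ L^{2*}(ℝ^N)`: an element is a function `u ∈ L^{2*}(ℝ^N)` together with
(a representative of) its weak gradient `∇u ∈ L²(ℝ^N; ℝ^N)`, such that for some sequence `φ n` of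
test functions `φ n → u` in `L^{2*}` and `∇ (φ n) → ∇u` in `L²`. -/
structure D12 (N : ℕ) where
  /-- the function `u` -/
  toFun : Space N → ℝ
  /-- its weak gradient `∇u` -/
  grad : Space N → Space N
  memLp_toFun : MemLp toFun (sobolevExponent N) volume
  memLp_grad : MemLp grad 2 volume
  hasWeakGradient : HasWeakGradient ⊤ toFun grad
  exists_approx : ∃ φ : ℕ → 𝓓((⊤ : Opens (Space N)), ℝ),
    Tendsto (fun n => eLpNorm (fun x => φ n x - toFun x) (sobolevExponent N) volume)
      atTop (𝓝 0) ∧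
    Tendsto (fun n => eLpNorm (fun x => gradient (φ n) x - grad x) 2 volume) atTop (𝓝 0)

/-- The upper critical exponent `2*_μ = (2N - μ) / (N - 2)`. -/
def criticalExponent (N : ℕ) (μ : ℝ) : ℝ := (2 * (N : ℝ) - μ) / ((N : ℝ) - 2)

/-- The nonlocal term `∫_Ω ∫_Ω (u⁺(x))^p (u⁺(y))^p / |x - y|^μ dx dy`. -/
def nonlocalTerm (Ω : Set (Space N)) (μ p : ℝ) (u : Space N → ℝ) : ℝ :=
  ∫ z in Ω ×ˢ Ω, (max (u z.1) 0) ^ p * (max (u z.2) 0) ^ p / ‖z.1 - z.2‖ ^ μ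

/-- The functional
`I(u) = 1/2 ∫_Ω |∇u|² + lam/2 ∫_Ω u² - 1/(2p) ∫_Ω ∫_Ω (u⁺(x))^p (u⁺(y))^p / |x - y|^μ`
on `H¹₀(Ω)`. -/
def energy (Ω : Opens (Space N)) (lam μ p : ℝ) (u : H10 Ω) : ℝ :=
  1 / 2 * (∫ x in (Ω : Set (Space N)), ‖u.grad x‖ ^ 2)
    + lam / 2 * (∫ x in (Ω : Set (Space N)), u.toFun x ^ 2)
    - 1 / (2 * p) * nonlocalTerm (Ω : Set (Space N)) μ p u.toFun

/-- The Nehari manifold of `energy`: the `u ∈ H¹₀(Ω)`, `u ≠ 0`, with `I'(u)[u] = 0`, that is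
`∫_Ω (|∇u|² + lam u²) = ∫_Ω ∫_Ω (u⁺(x))^p (u⁺(y))^p / |x - y|^μ`. -/
def nehari (Ω : Opens (Space N)) (lam μ p : ℝ) : Set (H10 Ω) :=
  {u | ¬ (u.toFun =ᵐ[volume.restrict (Ω : Set (Space N))] 0) ∧
    (∫ x in (Ω : Set (Space N)), (‖u.grad x‖ ^ 2 + lam * u.toFun x ^ 2))
      - nonlocalTerm (Ω : Set (Space N)) μ p u.toFun = 0}

/-- The ground-state level: the infimum of `energy` on its Nehari manifold. -/
def groundLevel (Ω : Opens (Space N)) (lam μ p : ℝ) : ℝ :=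
  sInf (energy Ω lam μ p '' nehari Ω lam μ p)

/-- The functional
`I_*(u) = 1/2 ∫ |∇u|² - 1/(2·2*_μ) ∫ ∫ (u⁺(x))^{2*_μ} (u⁺(y))^{2*_μ} / |x - y|^μ`
on `D^{1,2}(ℝ^N)`. -/
def criticalEnergy (N : ℕ) (μ : ℝ) (u : D12 N) : ℝ :=
  1 / 2 * (∫ x, ‖u.grad x‖ ^ 2)
    - 1 / (2 * criticalExponent N μ) *
      nonlocalTerm Set.univ μ (criticalExponent N μ) u.toFun

/-- The Nehari manifold of `criticalEnergy`: the `u ∈ D^{1,2}(ℝ^N)`, `u ≠ 0`, with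
`I_*'(u)[u] = 0`. -/
def criticalNehari (N : ℕ) (μ : ℝ) : Set (D12 N) :=
  {u | ¬ (u.toFun =ᵐ[volume] 0) ∧
    (∫ x, ‖u.grad x‖ ^ 2) = nonlocalTerm Set.univ μ (criticalExponent N μ) u.toFun}

/-- The ground-state level `m_*` of the critical problem in `ℝ^N`. -/
def criticalLevel (N : ℕ) (μ : ℝ) : ℝ :=
  sInf (criticalEnergy N μ '' criticalNehari N μ)

end Choquard

end

/-!
For `p > 1` every function `u` with nonlocal term `B_p(u) > 0` has a unique positive multiple on the
Nehari manifold, and its energy is `(1/2 - 1/(2p)) (A(u)^p / B_p(u))^(1/(p-1))`, where `A` is the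
quadratic part. Both levels are therefore governed by the quotient `A^p / B_p`, and by density it
suffices to evaluate it on test functions. Write `q` for the critical exponent.

*Upper bound.* An almost minimizing element of the critical Nehari manifold is approximated by a
test function. For `p = q` and `lam = 0` the quotient is invariant under `φ ↦ φ ((x - x₀) / δ)`,
while the term with `lam` is of lower order as `δ → 0`, so the test function may be concentrated
inside `Ω` (`exists_testFunction_quadForm_lt`). On a fixed test function `B_p` depends continuously
on `p`, by dominated convergence (`eventually_groundLevel_lt`).

*Lower bound.* With `k = m_* / (1/2 - 1/(2q))`, test functions satisfy `B_q k^(q-1) ≤ A^q`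
(`nonlocalTerm_mul_level_le`). Since `|x - y|^(-μ)` has finite mass on `Ω × Ω`, Hölder's inequality
turns this into an inequality for `B_p` with a constant that converges as `p → q`; it extends to
`H¹₀(Ω)` and bounds the energy on the Nehari manifold from below (`le_groundLevel`).

Only lower semicontinuity of `B_p` along approximating test functions is needed, which is Fatou's
lemma (`nonlocalTerm_le_of_tendsto`), and the case `m_* = 0` need not be excluded. So the
Hardy-Littlewood-Sobolev inequality plays no role. The Sobolev inequality enters only to show that
elements with vanishing gradient vanish (`IsTestLimit.ae_eq_zero`).
-/

namespace Choquard

variable {N : ℕ} {Ω : Opens (Space N)}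

/-! ### Test functions as elements of the energy spaces -/

lemma norm_gradient (f : Space N → ℝ) (x : Space N) : ‖gradient f x‖ = ‖fderiv ℝ f x‖ := by
  rw [gradient, LinearIsometryEquiv.norm_map]

lemma continuous_fderiv_testFunction (φ : 𝓓(Ω, ℝ)) : Continuous (fderiv ℝ φ) :=
  φ.contDiff.continuous_fderiv (by simp)

lemma continuous_gradient (φ : 𝓓(Ω, ℝ)) : Continuous (gradient φ) :=
  (LinearIsometryEquiv.continuous _).comp (continuous_fderiv_testFunction φ)

lemma gradient_eq_zero_of_notMem (φ : 𝓓(Ω, ℝ)) {x : Space N} (hx : x ∉ (Ω : Set (Space N))) :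
    gradient φ x = 0 := by
  rw [gradient, fderiv_of_notMem_tsupport ℝ (fun h => hx (φ.tsupport_subset h)), map_zero]

lemma testFunction_eq_zero_of_notMem (φ : 𝓓(Ω, ℝ)) {x : Space N}
    (hx : x ∉ (Ω : Set (Space N))) : φ x = 0 :=
  image_eq_zero_of_notMem_tsupport (fun h => hx (φ.tsupport_subset h))

lemma hasCompactSupport_gradient (φ : 𝓓(Ω, ℝ)) : HasCompactSupport (gradient φ) :=
  (φ.hasCompactSupport.fderiv ℝ).comp_left (g := (InnerProductSpace.toDual ℝ (Space N)).symm)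
    (map_zero _)

lemma memLp_testFunction (φ : 𝓓(Ω, ℝ)) (q : ℝ≥0∞) : MemLp φ q volume :=
  φ.continuous.memLp_of_hasCompactSupport φ.hasCompactSupport

lemma memLp_gradient (φ : 𝓓(Ω, ℝ)) (q : ℝ≥0∞) : MemLp (gradient φ) q volume :=
  (continuous_gradient φ).memLp_of_hasCompactSupport (hasCompactSupport_gradient φ)

lemma hasWeakGradient_gradient (φ : 𝓓(Ω, ℝ)) : HasWeakGradient Ω φ (gradient φ) := by
  intro ψ v
  have hfv : ∀ η : 𝓓(Ω, ℝ), Continuous fun x => fderiv ℝ η x v := fun η =>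
    (continuous_fderiv_testFunction η).clm_apply continuous_const
  rw [setIntegral_eq_integral_of_forall_compl_eq_zero
      (fun x hx => by rw [testFunction_eq_zero_of_notMem φ hx, zero_mul]),
    setIntegral_eq_integral_of_forall_compl_eq_zero
      (fun x hx => by rw [testFunction_eq_zero_of_notMem ψ hx, zero_mul])]
  simp only [inner_gradient_left, mul_comm (ψ _)]
  refine integral_mul_fderiv_eq_neg_fderiv_mul_of_integrable ?_ ?_ ?_ ?_ ?_
  · exact ((hfv φ).mul ψ.continuous).integrable_of_hasCompactSupport
      ψ.hasCompactSupport.mul_left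
  · exact (φ.continuous.mul (hfv ψ)).integrable_of_hasCompactSupport
      φ.hasCompactSupport.mul_right
  · exact (φ.continuous.mul ψ.continuous).integrable_of_hasCompactSupport
      φ.hasCompactSupport.mul_right
  · exact fun x _ => (φ.contDiff.differentiable (by simp)) x
  · exact fun x _ => (ψ.contDiff.differentiable (by simp)) x

/-- A test function as an element of `H¹₀(Ω)`. -/
noncomputable def H10.ofTestFunction (φ : 𝓓(Ω, ℝ)) : H10 Ω where
  toFun := φ
  grad := gradient φ
  memLp_toFun := (memLp_testFunction φ 2).restrict _
  memLp_grad := (memLp_gradient φ 2).restrict _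
  hasWeakGradient := hasWeakGradient_gradient φ
  exists_approx := ⟨fun _ => φ, by simp, by simp⟩

/-- A test function as an element of `D^{1,2}(ℝ^N)`. -/
noncomputable def D12.ofTestFunction (φ : 𝓓((⊤ : Opens (Space N)), ℝ)) : D12 N where
  toFun := φ
  grad := gradient φ
  memLp_toFun := memLp_testFunction φ _
  memLp_grad := memLp_gradient φ 2
  hasWeakGradient := hasWeakGradient_gradient φ
  exists_approx := ⟨fun _ => φ, by simp, by simp⟩

lemma gradient_smul (φ : 𝓓(Ω, ℝ)) (t : ℝ) (x : Space N) :
    gradient (t • φ : 𝓓(Ω, ℝ)) x = t • gradient φ x := by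
  have h : ((t • φ : 𝓓(Ω, ℝ)) : Space N → ℝ) = fun y => t • φ y := by ext; simp
  rw [gradient, gradient, h, fderiv_fun_const_smul ((φ.contDiff.differentiable (by simp)) x),
    map_smul]

lemma setIntegral_norm_gradient_sq (φ : 𝓓(Ω, ℝ)) :
    ∫ x in (Ω : Set (Space N)), ‖gradient φ x‖ ^ 2 = ∫ x, ‖gradient φ x‖ ^ 2 :=
  setIntegral_eq_integral_of_forall_compl_eq_zero
    fun x hx => by simp [gradient_eq_zero_of_notMem φ hx]

lemma setIntegral_sq (φ : 𝓓(Ω, ℝ)) :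
    ∫ x in (Ω : Set (Space N)), φ x ^ 2 = ∫ x, φ x ^ 2 :=
  setIntegral_eq_integral_of_forall_compl_eq_zero
    fun x hx => by simp [testFunction_eq_zero_of_notMem φ hx]

/-! ### The nonlocal term -/

/-- The integrand of the nonlocal term. -/
noncomputable def choquardIntegrand (μ p : ℝ) (u : Space N → ℝ) (z : Space N × Space N) : ℝ :=
  (max (u z.1) 0) ^ p * (max (u z.2) 0) ^ p / ‖z.1 - z.2‖ ^ μ

lemma choquardIntegrand_nonneg (μ p : ℝ) (u : Space N → ℝ) (z : Space N × Space N) :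
    0 ≤ choquardIntegrand μ p u z := by
  unfold choquardIntegrand; positivity

lemma nonlocalTerm_nonneg (S : Set (Space N)) (μ p : ℝ) (u : Space N → ℝ) :
    0 ≤ nonlocalTerm S μ p u :=
  integral_nonneg fun z => choquardIntegrand_nonneg μ p u z

lemma integrableOn_riesz_kernel {μ : ℝ} (hN : 0 < N) (hμN : μ < N) {S : Set (Space N)}
    (hS : Bornology.IsBounded S) (hSm : MeasurableSet S) :
    IntegrableOn (fun z : Space N × Space N => 1 / ‖z.1 - z.2‖ ^ μ) (S ×ˢ S) := by
  obtain ⟨r, hr⟩ := hS.subset_closedBall 0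
  have hdim : Module.finrank ℝ (Space N) = N := by simp
  have hmeas : Measurable fun z : Space N => 1 / ‖z‖ ^ μ := by fun_prop
  have hloc : IntegrableOn (fun z : Space N => 1 / ‖z‖ ^ μ) (Metric.ball 0 (2 * r + 1)) :=
    integrableOn_ball_of_norm_le_rpow (C := 1) (α := μ) (by rw [hdim]; exact hN)
      (by rw [hdim]; exact hμN)
      (ae_of_all _ fun x => by
        rw [Real.norm_of_nonneg (by positivity), Real.rpow_neg (norm_nonneg _)]; simp)
      hmeas.aestronglyMeasurable
  have hfin : volume S ≠ ∞ := hS.measure_lt_top.ne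
  have hmeas2 : Measurable fun z : Space N × Space N => 1 / ‖z.1 - z.2‖ ^ μ := by fun_prop
  refine ⟨hmeas2.aestronglyMeasurable, ?_⟩
  rw [HasFiniteIntegral, Measure.volume_eq_prod, ← Measure.prod_restrict,
    lintegral_prod _ hmeas2.enorm.aemeasurable]
  have hbound : ∀ x ∈ S, ∫⁻ y in S, ‖1 / ‖x - y‖ ^ μ‖ₑ
      ≤ ∫⁻ z in Metric.ball 0 (2 * r + 1), ‖1 / ‖(z : Space N)‖ ^ μ‖ₑ := by
    intro x hx
    rw [← lintegral_indicator hSm, ← lintegral_indicator Metric.isOpen_ball.measurableSet,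
      ← lintegral_sub_left_eq_self (Set.indicator (Metric.ball 0 (2 * r + 1)) _) x]
    refine lintegral_mono fun y => ?_
    by_cases hy : y ∈ S
    · have hb : x - y ∈ Metric.ball (0 : Space N) (2 * r + 1) := by
        have h1 := hr hx
        have h2 := hr hy
        simp only [Metric.mem_closedBall, dist_zero_right, Metric.mem_ball] at *
        linarith [norm_sub_le x y]
      rw [Set.indicator_of_mem hy, Set.indicator_of_mem hb]
    · rw [Set.indicator_of_notMem hy]; exact zero_le
  calc _ ≤ ∫⁻ x in S, ∫⁻ z in Metric.ball 0 (2 * r + 1), ‖1 / ‖(z : Space N)‖ ^ μ‖ₑ :=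
        setLIntegral_mono' hSm hbound
    _ < ∞ := by
        rw [setLIntegral_const]
        exact ENNReal.mul_lt_top hloc.2 hfin.lt_top

lemma measurable_choquardIntegrand (μ p : ℝ) (φ : 𝓓(Ω, ℝ)) :
    Measurable (choquardIntegrand μ p φ) := by
  have := φ.continuous.measurable
  unfold choquardIntegrand
  fun_prop

lemma aestronglyMeasurable_choquardIntegrand (μ p : ℝ) {S : Set (Space N)} {u : Space N → ℝ}
    (hu : AEStronglyMeasurable u (volume.restrict S)) :
    AEStronglyMeasurable (choquardIntegrand μ p u) (volume.restrict (S ×ˢ S)) := by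
  rw [Measure.volume_eq_prod, ← Measure.prod_restrict]
  have h1 := (hu.comp_fst (ν := volume.restrict S)).aemeasurable
  have h2 := (hu.comp_snd (μ := volume.restrict S)).aemeasurable
  refine AEMeasurable.aestronglyMeasurable ?_
  unfold choquardIntegrand
  fun_prop

/-- A bound for the integrand which is uniform in the exponent, used both for integrability and
for dominated convergence. -/
lemma exists_choquardIntegrand_le (μ q : ℝ) (φ : 𝓓(Ω, ℝ)) :
    ∃ C : ℝ, ∀ p, 0 < p → p ≤ q → ∀ z, choquardIntegrand μ p φ z ≤
      (tsupport φ ×ˢ tsupport φ).indicator (fun z => C * (1 / ‖z.1 - z.2‖ ^ μ)) z := by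
  obtain ⟨M, hM⟩ := φ.continuous.bounded_above_of_compact_support φ.hasCompactSupport
  have hM0 : 0 ≤ M := (norm_nonneg _).trans (hM 0)
  refine ⟨(1 + M) ^ q * (1 + M) ^ q, fun p hp hpq z => ?_⟩
  by_cases hz : z ∈ tsupport φ ×ˢ tsupport φ
  · rw [Set.indicator_of_mem hz]
    have hb : ∀ x, (max (φ x) 0) ^ p ≤ (1 + M) ^ q := fun x =>
      (Real.rpow_le_rpow (le_max_right _ _) (max_le (by
        linarith [(le_abs_self (φ x)).trans (hM x)]) (by linarith)) hp.le).trans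
        (Real.rpow_le_rpow_of_exponent_le (by linarith) hpq)
    rw [choquardIntegrand, div_eq_mul_one_div]
    gcongr <;> exact hb _
  · rw [Set.indicator_of_notMem hz]
    have h0 : φ z.1 = 0 ∨ φ z.2 = 0 := by
      by_contra! h
      exact hz ⟨subset_tsupport _ h.1, subset_tsupport _ h.2⟩
    rcases h0 with h0 | h0 <;> simp [choquardIntegrand, h0, Real.zero_rpow hp.ne']

lemma integrable_indicator_tsupport {μ : ℝ} (hN : 0 < N) (hμN : μ < N) (φ : 𝓓(Ω, ℝ)) (C : ℝ) :
    Integrable ((tsupport φ ×ˢ tsupport φ).indicator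
      (fun z : Space N × Space N => C * (1 / ‖z.1 - z.2‖ ^ μ))) := by
  have hm : MeasurableSet (tsupport φ) := (isClosed_tsupport _).measurableSet
  rw [integrable_indicator_iff (hm.prod hm)]
  exact (integrableOn_riesz_kernel hN hμN φ.hasCompactSupport.isBounded hm).const_mul C

lemma integrable_choquardIntegrand {μ p : ℝ} (hN : 0 < N) (hμN : μ < N) (hp : 0 < p)
    (φ : 𝓓(Ω, ℝ)) : Integrable (choquardIntegrand μ p φ) := by
  obtain ⟨C, hC⟩ := exists_choquardIntegrand_le μ p φ
  refine (integrable_indicator_tsupport hN hμN φ C).mono'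
    (measurable_choquardIntegrand μ p φ).aestronglyMeasurable (ae_of_all _ fun z => ?_)
  rw [Real.norm_of_nonneg (choquardIntegrand_nonneg _ _ _ _)]
  exact hC p hp le_rfl z

lemma nonlocalTerm_eq_integral {μ p : ℝ} (hp : p ≠ 0) (φ : 𝓓(Ω, ℝ)) :
    nonlocalTerm (Ω : Set (Space N)) μ p φ = ∫ z, choquardIntegrand μ p φ z := by
  refine setIntegral_eq_integral_of_forall_compl_eq_zero fun z hz => ?_
  have h0 : φ z.1 = 0 ∨ φ z.2 = 0 := by
    by_contra! h
    exact hz ⟨φ.tsupport_subset (subset_tsupport _ h.1),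
      φ.tsupport_subset (subset_tsupport _ h.2)⟩
  rcases h0 with h0 | h0 <;> simp [h0, Real.zero_rpow hp]

lemma tendsto_nonlocalTerm_exponent {μ q : ℝ} (hN : 0 < N) (hμN : μ < N) (hq : 0 < q)
    (φ : 𝓓(Ω, ℝ)) :
    Tendsto (fun p => nonlocalTerm (Ω : Set (Space N)) μ p φ) (𝓝[<] q)
      (𝓝 (nonlocalTerm (Ω : Set (Space N)) μ q φ)) := by
  obtain ⟨C, hC⟩ := exists_choquardIntegrand_le μ q φ
  have hmem : ∀ᶠ p in 𝓝[<] q, 0 < p ∧ p ≤ q := by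
    filter_upwards [eventually_nhdsWithin_of_eventually_nhds (lt_mem_nhds hq),
      self_mem_nhdsWithin] with p h1 h2 using ⟨h1, le_of_lt h2⟩
  rw [nonlocalTerm_eq_integral hq.ne']
  refine Tendsto.congr' (f₁ := fun p => ∫ z, choquardIntegrand μ p φ z) ?_
    (tendsto_integral_filter_of_dominated_convergence _ ?_ ?_
      (integrable_indicator_tsupport hN hμN φ C) (ae_of_all _ fun z => ?_))
  · filter_upwards [hmem] with p hp
    rw [nonlocalTerm_eq_integral hp.1.ne']
  · exact Eventually.of_forall fun p => (measurable_choquardIntegrand μ p φ).aestronglyMeasurable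
  · filter_upwards [hmem] with p hp
    refine ae_of_all _ fun z => ?_
    rw [Real.norm_of_nonneg (choquardIntegrand_nonneg _ _ _ _)]
    exact hC p hp.1 hp.2 z
  · have h : ∀ a : ℝ, Tendsto (fun p : ℝ => a ^ p) (𝓝[<] q) (𝓝 (a ^ q)) := fun a =>
      (Real.continuousAt_const_rpow' hq.ne').tendsto.mono_left nhdsWithin_le_nhds
    exact ((h _).mul (h _)).div_const _

lemma nonlocalTerm_smul {S : Set (Space N)} {μ p t : ℝ} (ht : 0 < t) (u : Space N → ℝ) :
    nonlocalTerm S μ p (fun x => t * u x) = t ^ (2 * p) * nonlocalTerm S μ p u := by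
  have h : ∀ a : ℝ, (max (t * a) 0) ^ p = t ^ p * (max a 0) ^ p := fun a => by
    rw [← Real.mul_rpow ht.le (le_max_right _ _), mul_max_of_nonneg _ _ ht.le, mul_zero]
  rw [nonlocalTerm, nonlocalTerm, ← integral_const_mul]
  refine integral_congr_ae (ae_of_all _ fun z => ?_)
  simp only [h]
  rw [two_mul, Real.rpow_add ht]
  ring

/-- Hölder's inequality with respect to the measure `|x - y|^{-μ} dx dy` on `Ω × Ω`, comparing
the nonlocal term for a smaller exponent `θ q` with the one for the exponent `q`. -/
lemma nonlocalTerm_le_rpow_mul_rpow {μ q θ : ℝ} (hN : 0 < N) (hμN : μ < N) (hq : 0 < q)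
    (hθ : 0 < θ) (hθ1 : θ < 1) (hΩ : Bornology.IsBounded (Ω : Set (Space N))) (φ : 𝓓(Ω, ℝ)) :
    nonlocalTerm (Ω : Set (Space N)) μ (θ * q) φ ≤
      nonlocalTerm (Ω : Set (Space N)) μ q φ ^ θ *
        (∫ z in (Ω : Set (Space N)) ×ˢ (Ω : Set (Space N)), 1 / ‖z.1 - z.2‖ ^ μ) ^ (1 - θ) := by
  set S : Set (Space N × Space N) := (Ω : Set (Space N)) ×ˢ (Ω : Set (Space N)) with hS
  have hk : IntegrableOn (fun z : Space N × Space N => 1 / ‖z.1 - z.2‖ ^ μ) S :=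
    integrableOn_riesz_kernel hN hμN hΩ Ω.isOpen.measurableSet
  have hk0 : ∀ z : Space N × Space N, 0 ≤ 1 / ‖z.1 - z.2‖ ^ μ := fun z => by positivity
  have hi : ∀ p, 0 < p → IntegrableOn (choquardIntegrand μ p φ) S := fun p hp =>
    (integrable_choquardIntegrand hN hμN hp φ).integrableOn
  have key := ENNReal.lintegral_mul_norm_pow_le (μ := volume.restrict S)
    (f := fun z => ENNReal.ofReal (choquardIntegrand μ q φ z))
    (g := fun z => ENNReal.ofReal (1 / ‖z.1 - z.2‖ ^ μ))
    (measurable_choquardIntegrand μ q φ).ennreal_ofReal.aemeasurable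
    (by fun_prop) hθ.le (sub_nonneg.2 hθ1.le) (by ring)
  have hpt : ∀ z : Space N × Space N, ENNReal.ofReal (choquardIntegrand μ q φ z) ^ θ *
      ENNReal.ofReal (1 / ‖z.1 - z.2‖ ^ μ) ^ (1 - θ) =
      ENNReal.ofReal (choquardIntegrand μ (θ * q) φ z) := fun z => by
    rw [ENNReal.ofReal_rpow_of_nonneg (choquardIntegrand_nonneg _ _ _ _) hθ.le,
      ENNReal.ofReal_rpow_of_nonneg (hk0 z) (sub_nonneg.2 hθ1.le),
      ← ENNReal.ofReal_mul (Real.rpow_nonneg (choquardIntegrand_nonneg _ _ _ _) _)]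
    congr 1
    have ha := le_max_right (φ z.1) 0
    have hb := le_max_right (φ z.2) 0
    rw [choquardIntegrand, choquardIntegrand, div_eq_mul_one_div,
      Real.mul_rpow (by positivity) (hk0 z),
      mul_assoc, ← Real.rpow_add_of_nonneg (hk0 z) hθ.le (sub_nonneg.2 hθ1.le),
      add_sub_cancel, Real.rpow_one, Real.mul_rpow (by positivity) (by positivity),
      ← Real.rpow_mul ha, ← Real.rpow_mul hb, mul_comm q θ, ← div_eq_mul_one_div]
  simp only [hpt] at key
  rw [← ofReal_integral_eq_lintegral_ofReal (hi _ (mul_pos hθ hq))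
      (ae_of_all _ fun z => choquardIntegrand_nonneg _ _ _ _),
    ← ofReal_integral_eq_lintegral_ofReal (hi _ hq)
      (ae_of_all _ fun z => choquardIntegrand_nonneg _ _ _ _),
    ← ofReal_integral_eq_lintegral_ofReal hk (ae_of_all _ hk0),
    ENNReal.ofReal_rpow_of_nonneg
      (integral_nonneg fun z => choquardIntegrand_nonneg _ _ _ _) hθ.le,
    ENNReal.ofReal_rpow_of_nonneg (integral_nonneg hk0) (sub_nonneg.2 hθ1.le),
    ← ENNReal.ofReal_mul (Real.rpow_nonneg
      (integral_nonneg fun z => choquardIntegrand_nonneg _ _ _ _) _)] at key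
  refine (ENNReal.ofReal_le_ofReal_iff ?_).1 key
  exact mul_nonneg (Real.rpow_nonneg
    (integral_nonneg fun z => choquardIntegrand_nonneg _ _ _ _) _)
    (Real.rpow_nonneg (integral_nonneg hk0) _)

/-! ### Passing to the limit along test functions -/

/-- `u`, with gradient `G`, is a limit of test functions in `Ω`: `φ n → u` in `L^q(Ω)` and
`∇ (φ n) → G` in `L²(Ω)`. With `q = 2` this holds for the elements of `H¹₀(Ω)`, with `q = 2*` and
`Ω = ℝ^N` for those of `D^{1,2}(ℝ^N)`. -/
structure IsTestLimit (Ω : Opens (Space N)) (q : ℝ≥0∞) (u : Space N → ℝ)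
    (G : Space N → Space N) : Prop where
  exponent_ne_zero : q ≠ 0
  aestronglyMeasurable : AEStronglyMeasurable u (volume.restrict (Ω : Set (Space N)))
  memLp_grad : MemLp G 2 (volume.restrict (Ω : Set (Space N)))
  exists_approx : ∃ φ : ℕ → 𝓓(Ω, ℝ),
    Tendsto (fun n => eLpNorm (fun x => φ n x - u x) q
      (volume.restrict (Ω : Set (Space N)))) atTop (𝓝 0) ∧
    Tendsto (fun n => eLpNorm (fun x => gradient (φ n) x - G x) 2
      (volume.restrict (Ω : Set (Space N)))) atTop (𝓝 0)

lemma H10.isTestLimit (u : H10 Ω) : IsTestLimit Ω 2 u.toFun u.grad where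
  exponent_ne_zero := two_ne_zero
  aestronglyMeasurable := u.memLp_toFun.1
  memLp_grad := u.memLp_grad
  exists_approx := u.exists_approx

lemma sobolevExponent_ne_zero (hN : 3 ≤ N) : sobolevExponent N ≠ 0 := by
  have h3 : (3 : ℝ) ≤ N := by exact_mod_cast hN
  have : 0 < 2 * (N : ℝ) / ((N : ℝ) - 2) := div_pos (by linarith) (by linarith)
  simpa [sobolevExponent] using this

lemma D12.isTestLimit (hN : 3 ≤ N) (u : D12 N) :
    IsTestLimit ⊤ (sobolevExponent N) u.toFun u.grad where
  exponent_ne_zero := sobolevExponent_ne_zero hN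
  aestronglyMeasurable := by simpa using u.memLp_toFun.1
  memLp_grad := by simpa using u.memLp_grad
  exists_approx := by simpa using u.exists_approx

lemma toReal_eLpNorm_two_sq {α E : Type*} [MeasurableSpace α] [NormedAddCommGroup E]
    {ν : Measure α} {f : α → E} (hf : MemLp f 2 ν) :
    (eLpNorm f 2 ν).toReal ^ 2 = ∫ x, ‖f x‖ ^ 2 ∂ν := by
  have h0 : 0 ≤ ∫ x, ‖f x‖ ^ 2 ∂ν := integral_nonneg fun x => by positivity
  rw [hf.eLpNorm_eq_integral_rpow_norm two_ne_zero ENNReal.ofNat_ne_top]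
  simp only [ENNReal.toReal_ofNat, Real.rpow_two]
  rw [ENNReal.toReal_ofReal (by positivity), ← Real.rpow_natCast, ← Real.rpow_mul h0]
  norm_num

lemma tendsto_integral_norm_sq {α E : Type*} [MeasurableSpace α] [NormedAddCommGroup E]
    {ν : Measure α} {f : ℕ → α → E} {g : α → E} (hf : ∀ n, MemLp (f n) 2 ν) (hg : MemLp g 2 ν)
    (h : Tendsto (fun n => eLpNorm (fun x => f n x - g x) 2 ν) atTop (𝓝 0)) :
    Tendsto (fun n => ∫ x, ‖f n x‖ ^ 2 ∂ν) atTop (𝓝 (∫ x, ‖g x‖ ^ 2 ∂ν)) := by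
  have : Fact ((1 : ℝ≥0∞) ≤ 2) := ⟨one_le_two⟩
  have h1 := (Lp.tendsto_Lp_iff_tendsto_eLpNorm'' f hf g hg).2 h
  have h2 := (h1.norm).pow 2
  simpa only [Lp.norm_toLp, toReal_eLpNorm_two_sq (hf _), toReal_eLpNorm_two_sq hg] using h2

/-- The nonlocal term is lower semicontinuous along test functions, by Fatou's lemma. No
integrability is required of the limit: otherwise its nonlocal term is the junk value `0`. -/
lemma nonlocalTerm_le_of_tendsto {μ p : ℝ} (hN : 0 < N) (hμN : μ < N) (hp : 0 < p)
    {q : ℝ≥0∞} (hq : q ≠ 0) {u : Space N → ℝ} {φ : ℕ → 𝓓(Ω, ℝ)}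
    (hu : AEStronglyMeasurable u (volume.restrict (Ω : Set (Space N))))
    (h : Tendsto (fun n => eLpNorm (fun x => φ n x - u x) q
      (volume.restrict (Ω : Set (Space N)))) atTop (𝓝 0))
    {b : ℕ → ℝ} {c : ℝ} (hb : Tendsto b atTop (𝓝 c))
    (hle : ∀ n, nonlocalTerm (Ω : Set (Space N)) μ p (φ n) ≤ b n) :
    nonlocalTerm (Ω : Set (Space N)) μ p u ≤ c := by
  have hc : 0 ≤ c := ge_of_tendsto' hb fun n => (nonlocalTerm_nonneg _ _ _ _).trans (hle n)
  obtain ⟨ns, hns, hae⟩ := (tendstoInMeasure_of_tendsto_eLpNorm hq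
    (fun n => (φ n).continuous.aestronglyMeasurable) hu h).exists_seq_tendsto_ae
  set S : Set (Space N × Space N) := (Ω : Set (Space N)) ×ˢ (Ω : Set (Space N)) with hS
  have hae2 : ∀ᵐ z ∂(volume.restrict S), Tendsto
      (fun n => choquardIntegrand μ p (φ (ns n)) z) atTop (𝓝 (choquardIntegrand μ p u z)) := by
    rw [hS, Measure.volume_eq_prod, ← Measure.prod_restrict]
    filter_upwards [Measure.quasiMeasurePreserving_fst.ae hae,
      Measure.quasiMeasurePreserving_snd.ae hae] with z h1 h2
    have hr : ∀ {a : ℕ → ℝ} {l : ℝ}, Tendsto a atTop (𝓝 l) →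
        Tendsto (fun n => (max (a n) 0) ^ p) atTop (𝓝 ((max l 0) ^ p)) := fun ha =>
      (ha.max tendsto_const_nhds).rpow_const (Or.inr hp.le)
    exact ((hr h1).mul (hr h2)).div_const _
  rw [nonlocalTerm]
  change ∫ z in S, choquardIntegrand μ p u z ≤ c
  rw [integral_eq_lintegral_of_nonneg_ae (ae_of_all _ fun z => choquardIntegrand_nonneg _ _ _ _)
    (aestronglyMeasurable_choquardIntegrand μ p hu)]
  refine ENNReal.toReal_le_of_le_ofReal hc ?_
  calc ∫⁻ z in S, ENNReal.ofReal (choquardIntegrand μ p u z)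
      = ∫⁻ z in S, liminf (fun n => ENNReal.ofReal (choquardIntegrand μ p (φ (ns n)) z)) atTop := by
        refine lintegral_congr_ae ?_
        filter_upwards [hae2] with z hz
        exact (ENNReal.tendsto_ofReal hz).liminf_eq.symm
    _ ≤ liminf (fun n => ∫⁻ z in S, ENNReal.ofReal (choquardIntegrand μ p (φ (ns n)) z)) atTop :=
        lintegral_liminf_le fun n => (measurable_choquardIntegrand μ p _).ennreal_ofReal
    _ ≤ liminf (fun n => ENNReal.ofReal (b (ns n))) atTop := by
        refine liminf_le_liminf (Eventually.of_forall fun n => ?_)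
        rw [← ofReal_integral_eq_lintegral_ofReal
          (integrable_choquardIntegrand hN hμN hp _).integrableOn
          (ae_of_all _ fun z => choquardIntegrand_nonneg _ _ _ _)]
        exact ENNReal.ofReal_le_ofReal (hle _)
    _ = ENNReal.ofReal c :=
        (ENNReal.tendsto_ofReal (hb.comp hns.tendsto_atTop)).liminf_eq

/-- An inequality between the nonlocal term and the Dirichlet integral extends from test functions
to their limits. -/
lemma IsTestLimit.mul_nonlocalTerm_le {μ p : ℝ} (hN : 0 < N) (hμN : μ < N) (hp : 0 < p)
    {q : ℝ≥0∞} {u : Space N → ℝ} {G : Space N → Space N} (hu : IsTestLimit Ω q u G)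
    {C D : ℝ} (hC : 0 ≤ C) (hD : 0 ≤ D)
    (h : ∀ φ : 𝓓(Ω, ℝ), C * nonlocalTerm (Ω : Set (Space N)) μ p φ ≤
      (∫ x in (Ω : Set (Space N)), ‖gradient φ x‖ ^ 2) ^ p * D) :
    C * nonlocalTerm (Ω : Set (Space N)) μ p u ≤
      (∫ x in (Ω : Set (Space N)), ‖G x‖ ^ 2) ^ p * D := by
  obtain ⟨φ, h1, h2⟩ := hu.exists_approx
  rcases hC.eq_or_lt with rfl | hC
  · rw [zero_mul]; positivity
  have h3 := tendsto_integral_norm_sq (fun n => (memLp_gradient (φ n) 2).restrict _)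
    hu.memLp_grad h2
  rw [← le_div_iff₀' hC]
  refine nonlocalTerm_le_of_tendsto hN hμN hp hu.exponent_ne_zero hu.aestronglyMeasurable h1
    (((h3.rpow_const (Or.inr hp.le)).mul_const D).div_const C) fun n => ?_
  rw [le_div_iff₀' hC]
  exact h _

/-- By the Sobolev inequality, a limit of test functions with vanishing gradient vanishes. -/
lemma IsTestLimit.ae_eq_zero (hN : 3 ≤ N) {q : ℝ≥0∞} {u : Space N → ℝ}
    {G : Space N → Space N} (hu : IsTestLimit Ω q u G)
    (hG : ∫ x in (Ω : Set (Space N)), ‖G x‖ ^ 2 = 0) :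
    u =ᵐ[volume.restrict (Ω : Set (Space N))] 0 := by
  obtain ⟨φ, h1, h2⟩ := hu.exists_approx
  have hN3 : (3 : ℝ) ≤ N := by exact_mod_cast hN
  have hG0 : eLpNorm G 2 (volume.restrict (Ω : Set (Space N))) = 0 := by
    have := toReal_eLpNorm_two_sq hu.memLp_grad
    rw [hG, sq_eq_zero_iff, ENNReal.toReal_eq_zero_iff] at this
    exact this.resolve_right hu.memLp_grad.2.ne
  have hGae : G =ᵐ[volume.restrict (Ω : Set (Space N))] 0 :=
    (eLpNorm_eq_zero_iff hu.memLp_grad.1 two_ne_zero).1 hG0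
  have hgrad : ∀ n, eLpNorm (fun x => gradient (φ n) x - G x) 2
      (volume.restrict (Ω : Set (Space N))) = eLpNorm (fderiv ℝ (φ n)) 2 volume := fun n => by
    have hs : (Function.support (fderiv ℝ (φ n))) ⊆ (Ω : Set (Space N)) :=
      (support_fderiv_subset ℝ).trans (φ n).tsupport_subset
    rw [← eLpNorm_restrict_eq_of_support_subset (f := fderiv ℝ (φ n)) hs]
    refine eLpNorm_congr_norm_ae ?_
    filter_upwards [hGae] with x hx
    rw [hx, Pi.zero_apply, sub_zero, norm_gradient]
  simp only [hgrad] at h2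
  have hr : 0 ≤ 2 * (N : ℝ) / ((N : ℝ) - 2) := div_nonneg (by linarith) (by linarith)
  let r : NNReal := ⟨2 * (N : ℝ) / ((N : ℝ) - 2), hr⟩
  have hdim : Module.finrank ℝ (Space N) = N := by simp
  have hr0 : (r : ℝ≥0∞) ≠ 0 := by
    have : 0 < 2 * (N : ℝ) / ((N : ℝ) - 2) := div_pos (by linarith) (by linarith)
    have h' : r ≠ 0 := fun h => this.ne' (congrArg NNReal.toReal h)
    exact_mod_cast h'
  have hrinv : ((r : ℝ))⁻¹ = ((2 : NNReal) : ℝ)⁻¹ - (Module.finrank ℝ (Space N) : ℝ)⁻¹ := by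
    have hr' : (r : ℝ) = 2 * (N : ℝ) / ((N : ℝ) - 2) := rfl
    rw [hdim, hr']
    have : (N : ℝ) - 2 ≠ 0 := by linarith
    push_cast
    field_simp
  have hsob : ∀ n, eLpNorm (fun x => φ n x - (0 : Space N → ℝ) x) r
      (volume.restrict (Ω : Set (Space N))) ≤
      SNormLESNormFDerivOfEqConst ℝ (volume : Measure (Space N)) ((2 : NNReal) : ℝ) *
        eLpNorm (fderiv ℝ (φ n)) 2 volume := fun n => by
    simp only [Pi.zero_apply, sub_zero]
    exact (eLpNorm_restrict_le _ _ _ _).trans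
      (eLpNorm_le_eLpNorm_fderiv_of_eq volume ((φ n).contDiff.of_le (by simp))
        (φ n).hasCompactSupport one_le_two (by rw [hdim]; omega) hrinv)
  have h3 := tendsto_of_tendsto_of_tendsto_of_le_of_le tendsto_const_nhds
    (by simpa using ENNReal.Tendsto.const_mul (a := (SNormLESNormFDerivOfEqConst ℝ
      (volume : Measure (Space N)) ((2 : NNReal) : ℝ) : ℝ≥0∞)) h2 (Or.inr ENNReal.coe_ne_top))
    (fun n => zero_le) hsob
  exact tendstoInMeasure_ae_unique
    (tendstoInMeasure_of_tendsto_eLpNorm hu.exponent_ne_zero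
      (fun n => (φ n).continuous.aestronglyMeasurable) hu.aestronglyMeasurable h1)
    (tendstoInMeasure_of_tendsto_eLpNorm hr0
      (fun n => (φ n).continuous.aestronglyMeasurable) aestronglyMeasurable_zero h3)

lemma nonlocalTerm_eq_zero_of_ae {μ p : ℝ} (hp : p ≠ 0) {S : Set (Space N)} {u : Space N → ℝ}
    (hu : u =ᵐ[volume.restrict S] 0) : nonlocalTerm S μ p u = 0 := by
  refine integral_eq_zero_of_ae ?_
  rw [Measure.volume_eq_prod, ← Measure.prod_restrict]
  filter_upwards [Measure.quasiMeasurePreserving_fst.ae hu] with z hz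
  simp [hz, Real.zero_rpow hp]

/-! ### Projection onto the Nehari manifolds -/

lemma exists_nehari_scaling {A B p k : ℝ} (hA : 0 < A) (hB : 0 < B) (hp : 1 < p) (hk : 0 ≤ k)
    (h : A ^ p ≤ B * k ^ (p - 1)) :
    ∃ t : ℝ, 0 < t ∧ t ^ 2 * A = t ^ (2 * p) * B ∧ t ^ 2 * A ≤ k := by
  have hp1 : 0 < p - 1 := by linarith
  have hAB : 0 < A / B := div_pos hA hB
  set t := (A / B) ^ (1 / (2 * (p - 1))) with ht
  have ht0 : 0 < t := Real.rpow_pos_of_pos hAB _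
  have ht1 : t ^ (2 * (p - 1)) = A / B := by
    rw [ht, ← Real.rpow_mul hAB.le, one_div_mul_cancel (by positivity), Real.rpow_one]
  refine ⟨t, ht0, ?_, ?_⟩
  · rw [show 2 * p = 2 * (p - 1) + 2 by ring, Real.rpow_add ht0, ht1, Real.rpow_two]
    field_simp
  · rw [← Real.rpow_le_rpow_iff (by positivity) hk hp1, Real.mul_rpow (by positivity) hA.le,
      ← Real.rpow_two, ← Real.rpow_mul ht0.le, ht1, div_mul_eq_mul_div, div_le_iff₀ hB,
      mul_comm _ B]
    calc A * A ^ (p - 1) = A ^ p := by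
          rw [← Real.rpow_one_add' hA.le (by linarith)]; congr 1; ring
      _ ≤ _ := h

/-- The quadratic part `∫_Ω (|∇φ|² + lam φ²)` of the energy at a test function. -/
noncomputable def quadForm (lam : ℝ) (φ : 𝓓(Ω, ℝ)) : ℝ :=
  (∫ x, ‖gradient φ x‖ ^ 2) + lam * ∫ x, φ x ^ 2

lemma H10.integral_add (u : H10 Ω) (lam : ℝ) :
    ∫ x in (Ω : Set (Space N)), (‖u.grad x‖ ^ 2 + lam * u.toFun x ^ 2) =
      (∫ x in (Ω : Set (Space N)), ‖u.grad x‖ ^ 2) +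
        lam * ∫ x in (Ω : Set (Space N)), u.toFun x ^ 2 := by
  rw [MeasureTheory.integral_add u.memLp_grad.norm.integrable_sq
    (u.memLp_toFun.integrable_sq.const_mul lam), integral_const_mul]

lemma energy_of_mem_nehari {lam μ p : ℝ} {u : H10 Ω} (hu : u ∈ nehari Ω lam μ p) :
    energy Ω lam μ p u = (1 / 2 - 1 / (2 * p)) *
      ((∫ x in (Ω : Set (Space N)), ‖u.grad x‖ ^ 2) +
        lam * ∫ x in (Ω : Set (Space N)), u.toFun x ^ 2) := by
  have h := hu.2
  rw [u.integral_add] at h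
  rw [energy, ← sub_eq_zero.1 h]
  ring

lemma criticalEnergy_of_mem {μ : ℝ} {u : D12 N} (hu : u ∈ criticalNehari N μ) :
    criticalEnergy N μ u =
      (1 / 2 - 1 / (2 * criticalExponent N μ)) * ∫ x, ‖u.grad x‖ ^ 2 := by
  rw [criticalEnergy, ← hu.2]
  ring

lemma half_sub_pos {p : ℝ} (hp : 1 < p) : 0 < 1 / 2 - 1 / (2 * p) := by
  rw [sub_pos]
  exact one_div_lt_one_div_of_lt (by norm_num) (by linarith)

lemma bddBelow_energy_nehari {lam μ p : ℝ} (hlam : 0 ≤ lam) (hp : 1 < p) :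
    BddBelow (energy Ω lam μ p '' nehari Ω lam μ p) := by
  refine ⟨0, ?_⟩
  rintro _ ⟨u, hu, rfl⟩
  rw [energy_of_mem_nehari hu]
  have h1 := half_sub_pos hp
  have h2 : 0 ≤ ∫ x in (Ω : Set (Space N)), u.toFun x ^ 2 := integral_nonneg fun x => sq_nonneg _
  positivity

lemma bddBelow_criticalEnergy {μ : ℝ} (hp : 1 < criticalExponent N μ) :
    BddBelow (criticalEnergy N μ '' criticalNehari N μ) := by
  refine ⟨0, ?_⟩
  rintro _ ⟨u, hu, rfl⟩
  rw [criticalEnergy_of_mem hu]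
  have h1 := half_sub_pos hp
  positivity

lemma integral_norm_gradient_sq_pos {μ p : ℝ} (hN : 3 ≤ N) (hp : 1 < p) {φ : 𝓓(Ω, ℝ)}
    (hB : 0 < nonlocalTerm (Ω : Set (Space N)) μ p φ) : 0 < ∫ x, ‖gradient φ x‖ ^ 2 := by
  refine lt_of_le_of_ne (integral_nonneg fun x => sq_nonneg _) fun h => hB.ne' ?_
  refine nonlocalTerm_eq_zero_of_ae (by linarith)
    ((H10.ofTestFunction φ).isTestLimit.ae_eq_zero hN ?_)
  exact (setIntegral_norm_gradient_sq φ).trans h.symm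

lemma integral_norm_gradient_smul (φ : 𝓓(Ω, ℝ)) (t : ℝ) :
    ∫ x, ‖gradient (t • φ : 𝓓(Ω, ℝ)) x‖ ^ 2 = t ^ 2 * ∫ x, ‖gradient φ x‖ ^ 2 := by
  rw [← integral_const_mul]
  refine integral_congr_ae (ae_of_all _ fun x => ?_)
  simp only [gradient_smul, norm_smul, mul_pow, Real.norm_eq_abs, sq_abs]

lemma coe_smul_testFunction (φ : 𝓓(Ω, ℝ)) (t : ℝ) :
    ((t • φ : 𝓓(Ω, ℝ)) : Space N → ℝ) = fun x => t * φ x := by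
  ext; simp

/-- A multiple of a test function lies on the Nehari manifold, which yields an upper bound for the
ground-state level. -/
lemma groundLevel_le {lam μ p k : ℝ} (hN : 3 ≤ N) (hlam : 0 ≤ lam) (hp : 1 < p) (hk : 0 ≤ k)
    (φ : 𝓓(Ω, ℝ)) (hB : 0 < nonlocalTerm (Ω : Set (Space N)) μ p φ)
    (h : quadForm lam φ ^ p ≤ nonlocalTerm (Ω : Set (Space N)) μ p φ * k ^ (p - 1)) :
    (nehari Ω lam μ p).Nonempty ∧ groundLevel Ω lam μ p ≤ (1 / 2 - 1 / (2 * p)) * k := by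
  have hL : 0 ≤ ∫ x, φ x ^ 2 := integral_nonneg fun x => sq_nonneg _
  have hA : 0 < quadForm lam φ :=
    add_pos_of_pos_of_nonneg (integral_norm_gradient_sq_pos hN hp hB) (mul_nonneg hlam hL)
  obtain ⟨t, ht, htB, htk⟩ := exists_nehari_scaling hA hB hp hk h
  let u : H10 Ω := H10.ofTestFunction (t • φ)
  have hnl : nonlocalTerm (Ω : Set (Space N)) μ p u.toFun =
      t ^ (2 * p) * nonlocalTerm (Ω : Set (Space N)) μ p φ := by
    rw [← nonlocalTerm_smul ht, ← coe_smul_testFunction]; rfl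
  have hq : (∫ x in (Ω : Set (Space N)), ‖u.grad x‖ ^ 2) +
      lam * ∫ x in (Ω : Set (Space N)), u.toFun x ^ 2 = t ^ 2 * quadForm lam φ := by
    change (∫ x in (Ω : Set (Space N)), ‖gradient (t • φ : 𝓓(Ω, ℝ)) x‖ ^ 2) +
      lam * ∫ x in (Ω : Set (Space N)), (t • φ : 𝓓(Ω, ℝ)) x ^ 2 = _
    rw [setIntegral_norm_gradient_sq, setIntegral_sq, integral_norm_gradient_smul,
      coe_smul_testFunction, quadForm]
    simp only [mul_pow, integral_const_mul]
    ring
  have hu : u ∈ nehari Ω lam μ p := by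
    refine ⟨fun h0 => ?_, ?_⟩
    · have := nonlocalTerm_eq_zero_of_ae (μ := μ) (p := p) (by linarith) h0
      rw [hnl] at this
      exact (mul_pos (Real.rpow_pos_of_pos ht _) hB).ne' this
    · rw [u.integral_add, hnl, hq, htB, sub_self]
  refine ⟨⟨u, hu⟩, (csInf_le (bddBelow_energy_nehari hlam hp) ⟨u, hu, rfl⟩).trans ?_⟩
  rw [energy_of_mem_nehari hu, hq]
  exact mul_le_mul_of_nonneg_left htk (half_sub_pos hp).le

/-- The analogue of `groundLevel_le` for the critical problem in `ℝ^N`. -/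
lemma criticalLevel_le {μ k : ℝ} (hN : 3 ≤ N) (hp : 1 < criticalExponent N μ) (hk : 0 ≤ k)
    (φ : 𝓓((⊤ : Opens (Space N)), ℝ))
    (hB : 0 < nonlocalTerm Set.univ μ (criticalExponent N μ) φ)
    (h : (∫ x, ‖gradient φ x‖ ^ 2) ^ criticalExponent N μ ≤
      nonlocalTerm Set.univ μ (criticalExponent N μ) φ * k ^ (criticalExponent N μ - 1)) :
    (criticalNehari N μ).Nonempty ∧
      criticalLevel N μ ≤ (1 / 2 - 1 / (2 * criticalExponent N μ)) * k := by
  have hA := integral_norm_gradient_sq_pos (Ω := ⊤) hN hp (φ := φ) (by simpa using hB)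
  obtain ⟨t, ht, htB, htk⟩ := exists_nehari_scaling hA hB hp hk h
  let u : D12 N := D12.ofTestFunction (t • φ)
  have hnl : nonlocalTerm Set.univ μ (criticalExponent N μ) u.toFun =
      t ^ (2 * criticalExponent N μ) * nonlocalTerm Set.univ μ (criticalExponent N μ) φ := by
    rw [← nonlocalTerm_smul ht, ← coe_smul_testFunction]; rfl
  have hq : ∫ x, ‖u.grad x‖ ^ 2 = t ^ 2 * ∫ x, ‖gradient φ x‖ ^ 2 :=
    integral_norm_gradient_smul φ t
  have hu : u ∈ criticalNehari N μ := by
    refine ⟨fun h0 => ?_, by rw [hnl, hq, htB]⟩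
    have := nonlocalTerm_eq_zero_of_ae (S := Set.univ) (μ := μ) (p := criticalExponent N μ)
      (by linarith) (by simpa using h0)
    rw [hnl] at this
    exact (mul_pos (Real.rpow_pos_of_pos ht _) hB).ne' this
  refine ⟨⟨u, hu⟩, (csInf_le (bddBelow_criticalEnergy hp) ⟨u, hu, rfl⟩).trans ?_⟩
  rw [criticalEnergy_of_mem hu, hq]
  exact mul_le_mul_of_nonneg_left htk (half_sub_pos hp).le

/-! ### Concentrating a test function -/

lemma eventually_exists_concentrated (φ : 𝓓((⊤ : Opens (Space N)), ℝ)) {x₀ : Space N}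
    (hx₀ : x₀ ∈ (Ω : Set (Space N))) :
    ∀ᶠ δ in 𝓝[>] (0 : ℝ), ∃ ψ : 𝓓(Ω, ℝ), ∀ x, ψ x = φ (δ⁻¹ • (x - x₀)) := by
  obtain ⟨R, hR0, hR⟩ := φ.hasCompactSupport.isBounded.subset_closedBall_lt 0 0
  obtain ⟨r, hr0, hr⟩ := Metric.isOpen_iff.1 Ω.isOpen x₀ hx₀
  filter_upwards [Ioo_mem_nhdsGT (div_pos hr0 hR0)] with δ hδ
  have hδ0 : 0 < δ := hδ.1
  have hsupp : Function.support (fun x => φ (δ⁻¹ • (x - x₀))) ⊆ Metric.closedBall x₀ (δ * R) := by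
    intro x hx
    have h1 := hR (subset_tsupport _ hx)
    rw [mem_closedBall_zero_iff, norm_smul, Real.norm_of_nonneg (inv_nonneg.2 hδ0.le),
      inv_mul_le_iff₀ hδ0] at h1
    rwa [mem_closedBall_iff_norm]
  refine ⟨⟨fun x => φ (δ⁻¹ • (x - x₀)), ?_, ?_, ?_⟩, fun x => rfl⟩
  · exact φ.contDiff.comp ((contDiff_id.sub contDiff_const).const_smul δ⁻¹)
  · exact HasCompactSupport.of_support_subset_isCompact (isCompact_closedBall _ _) hsupp
  · refine (closure_minimal hsupp Metric.isClosed_closedBall).trans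
      ((Metric.closedBall_subset_ball ?_).trans hr)
    have := hδ.2
    rwa [lt_div_iff₀ hR0] at this

lemma integral_comp_concentrated (g : Space N → ℝ) (x₀ : Space N) {δ : ℝ} (hδ : 0 < δ) :
    ∫ x, g (δ⁻¹ • (x - x₀)) = δ ^ N * ∫ x, g x := by
  rw [integral_sub_right_eq_self (fun x => g (δ⁻¹ • x)) x₀,
    Measure.integral_comp_inv_smul_of_nonneg volume g hδ.le]
  simp

lemma norm_gradient_concentrated {φ : 𝓓((⊤ : Opens (Space N)), ℝ)} {ψ : 𝓓(Ω, ℝ)} {x₀ : Space N}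
    {δ : ℝ} (hδ : 0 < δ) (h : ∀ x, ψ x = φ (δ⁻¹ • (x - x₀))) (x : Space N) :
    ‖gradient ψ x‖ = δ⁻¹ * ‖gradient φ (δ⁻¹ • (x - x₀))‖ := by
  have h1 : HasFDerivAt (fun x : Space N => δ⁻¹ • (x - x₀))
      (δ⁻¹ • ContinuousLinearMap.id ℝ (Space N)) x :=
    ((hasFDerivAt_id x).sub_const x₀).const_smul δ⁻¹
  have h2 := ((φ.contDiff.differentiable (by simp)) (δ⁻¹ • (x - x₀))).hasFDerivAt.comp x h1
  have h3 : (ψ : Space N → ℝ) = φ ∘ fun x : Space N => δ⁻¹ • (x - x₀) := funext h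
  rw [norm_gradient, norm_gradient, h3, h2.fderiv, ContinuousLinearMap.comp_smul,
    ContinuousLinearMap.comp_id, norm_smul, Real.norm_of_nonneg (inv_nonneg.2 hδ.le)]

lemma quadForm_concentrated {φ : 𝓓((⊤ : Opens (Space N)), ℝ)} {ψ : 𝓓(Ω, ℝ)} {x₀ : Space N}
    {δ : ℝ} (hδ : 0 < δ) (h : ∀ x, ψ x = φ (δ⁻¹ • (x - x₀))) (lam : ℝ) :
    quadForm lam ψ = δ ^ ((N : ℝ) - 2) *
      ((∫ x, ‖gradient φ x‖ ^ 2) + lam * δ ^ 2 * ∫ x, φ x ^ 2) := by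
  rw [quadForm]
  simp only [norm_gradient_concentrated hδ h, h, mul_pow, integral_const_mul]
  rw [integral_comp_concentrated (fun x => ‖gradient φ x‖ ^ 2) x₀ hδ,
    integral_comp_concentrated (fun x => φ x ^ 2) x₀ hδ, Real.rpow_sub hδ, Real.rpow_natCast,
    Real.rpow_two]
  field_simp

lemma nonlocalTerm_concentrated {φ : 𝓓((⊤ : Opens (Space N)), ℝ)} {ψ : 𝓓(Ω, ℝ)} {x₀ : Space N}
    {δ : ℝ} (hδ : 0 < δ) (h : ∀ x, ψ x = φ (δ⁻¹ • (x - x₀))) {μ p : ℝ} (hp : p ≠ 0) :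
    nonlocalTerm (Ω : Set (Space N)) μ p ψ =
      δ ^ (2 * (N : ℝ) - μ) * nonlocalTerm Set.univ μ p φ := by
  have hφ : nonlocalTerm Set.univ μ p φ = ∫ z, choquardIntegrand μ p φ z := by
    simpa using nonlocalTerm_eq_integral (μ := μ) hp φ
  have hpt : ∀ z : Space N × Space N, choquardIntegrand μ p ψ z =
      δ ^ (-μ) * choquardIntegrand μ p φ (δ⁻¹ • (z - (x₀, x₀))) := fun z => by
    have hz : ‖δ⁻¹ • (z.1 - x₀) - δ⁻¹ • (z.2 - x₀)‖ = δ⁻¹ * ‖z.1 - z.2‖ := by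
      rw [← smul_sub, sub_sub_sub_cancel_right, norm_smul,
        Real.norm_of_nonneg (inv_nonneg.2 hδ.le)]
    simp only [choquardIntegrand, h, Prod.smul_fst, Prod.smul_snd, Prod.fst_sub, Prod.snd_sub, hz]
    rw [Real.mul_rpow (inv_nonneg.2 hδ.le) (norm_nonneg _), Real.inv_rpow hδ.le,
      Real.rpow_neg hδ.le]
    have := (Real.rpow_pos_of_pos hδ μ).ne'
    field_simp
  rw [nonlocalTerm_eq_integral hp, hφ]
  simp only [hpt, integral_const_mul]
  have : (volume : Measure (Space N × Space N)).IsAddHaarMeasure := by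
    rw [Measure.volume_eq_prod]; infer_instance
  rw [integral_sub_right_eq_self (fun z => choquardIntegrand μ p φ (δ⁻¹ • z)) (x₀, x₀),
    Measure.integral_comp_inv_smul_of_nonneg volume _ hδ.le, smul_eq_mul, ← mul_assoc,
    ← Real.rpow_natCast, ← Real.rpow_add hδ]
  simp only [Module.finrank_prod, finrank_euclideanSpace, Fintype.card_fin]
  push_cast
  ring_nf

/-! ### Bounds for the levels -/

lemma one_lt_criticalExponent {μ : ℝ} (hN : 3 ≤ N) (hμN : μ < N) : 1 < criticalExponent N μ := by
  have hN3 : (3 : ℝ) ≤ N := by exact_mod_cast hN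
  rw [criticalExponent, one_lt_div (by linarith)]
  linarith

lemma rpow_div_rpow_inv {A B p : ℝ} (hA : 0 ≤ A) (hB : 0 < B) (hp : 1 < p) :
    B * ((A ^ p / B) ^ (1 / (p - 1))) ^ (p - 1) = A ^ p := by
  rw [← Real.rpow_mul (by positivity), one_div_mul_cancel (by linarith), Real.rpow_one]
  field_simp

lemma criticalLevel_nonneg {μ : ℝ} (hp : 1 < criticalExponent N μ) : 0 ≤ criticalLevel N μ := by
  refine Real.sInf_nonneg ?_
  rintro _ ⟨u, hu, rfl⟩
  rw [criticalEnergy_of_mem hu]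
  have h1 := half_sub_pos hp
  positivity

/-- The critical level as the constant of an inequality on test functions. It contains no
information when `m_* = 0`; that case does not have to be excluded. -/
lemma nonlocalTerm_mul_level_le {μ : ℝ} (hN : 3 ≤ N) (hμN : μ < N) (φ : 𝓓(Ω, ℝ)) :
    nonlocalTerm (Ω : Set (Space N)) μ (criticalExponent N μ) φ *
      (criticalLevel N μ / (1 / 2 - 1 / (2 * criticalExponent N μ))) ^
        (criticalExponent N μ - 1) ≤
      (∫ x, ‖gradient φ x‖ ^ 2) ^ criticalExponent N μ := by
  have hp := one_lt_criticalExponent hN hμN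
  set q := criticalExponent N μ with hq
  have hc := half_sub_pos hp
  have hm := criticalLevel_nonneg hp
  have hA : 0 ≤ ∫ x, ‖gradient φ x‖ ^ 2 := integral_nonneg fun x => sq_nonneg _
  rcases (nonlocalTerm_nonneg (Ω : Set (Space N)) μ q φ).eq_or_lt with hB | hB
  · rw [← hB, zero_mul]; positivity
  · have hk := rpow_div_rpow_inv hA hB hp
    set k := ((∫ x, ‖gradient φ x‖ ^ 2) ^ q / nonlocalTerm (Ω : Set (Space N)) μ q φ) ^
      (1 / (q - 1)) with hkdef
    have hk0 : 0 ≤ k := by positivity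
    let φ' : 𝓓((⊤ : Opens (Space N)), ℝ) :=
      ⟨φ, φ.contDiff, φ.hasCompactSupport, Set.subset_univ _⟩
    have hφ' : nonlocalTerm Set.univ μ q φ' = nonlocalTerm (Ω : Set (Space N)) μ q φ := by
      have h1 := nonlocalTerm_eq_integral (μ := μ) (p := q) (by linarith) φ'
      rw [Opens.coe_top] at h1
      rw [h1, nonlocalTerm_eq_integral (by linarith)]
      rfl
    have := (criticalLevel_le hN hp hk0 φ' (by rw [hφ']; exact hB)
      (by rw [hφ']; exact hk.ge)).2
    rw [← hk]
    gcongr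
    rwa [div_le_iff₀' hc]

lemma criticalNehari_nonempty {μ : ℝ} (hN : 3 ≤ N) (hμN : μ < N) :
    (criticalNehari N μ).Nonempty := by
  have hp := one_lt_criticalExponent hN hμN
  let f : ContDiffBump (0 : Space N) := ⟨1, 2, one_pos, one_lt_two⟩
  let φ : 𝓓((⊤ : Opens (Space N)), ℝ) :=
    ⟨f, f.contDiff, f.hasCompactSupport, Set.subset_univ _⟩
  have hB : 0 < nonlocalTerm Set.univ μ (criticalExponent N μ) φ := by
    have h1 := nonlocalTerm_eq_integral (μ := μ) (p := criticalExponent N μ) (by linarith) φ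
    rw [Opens.coe_top] at h1
    rw [h1, integral_pos_iff_support_of_nonneg (choquardIntegrand_nonneg _ _ _)
      (integrable_choquardIntegrand (by omega) hμN (by linarith) φ)]
    let U : Set (Space N × Space N) := {z | 0 < φ z.1 ∧ 0 < φ z.2 ∧ z.1 ≠ z.2}
    have hφ := φ.continuous
    have hU : IsOpen U :=
      (isOpen_lt continuous_const (hφ.comp continuous_fst)).inter
        ((isOpen_lt continuous_const (hφ.comp continuous_snd)).inter
          (isOpen_ne_fun continuous_fst continuous_snd))
    have hUne : U.Nonempty := by
      let e : Space N := EuclideanSpace.single ⟨0, by omega⟩ 1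
      have he : ‖e‖ = 1 := by simp [e]
      have hone : ∀ x : Space N, ‖x‖ ≤ 1 → 0 < φ x := fun x hx => by
        have : φ x = 1 := f.one_of_mem_closedBall (by simpa [f] using hx)
        rw [this]; exact one_pos
      refine ⟨(0, e), hone 0 (by simp), hone e he.le, fun h0 => ?_⟩
      have h0' : (0 : Space N) = e := h0
      rw [← h0', norm_zero] at he
      exact zero_ne_one he
    have : (volume : Measure (Space N × Space N)).IsAddHaarMeasure := by
      rw [Measure.volume_eq_prod]; infer_instance
    refine (hU.measure_pos volume hUne).trans_le (measure_mono fun z hz => ?_)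
    have hz1 : 0 < φ z.1 := hz.1
    have hz2 : 0 < φ z.2 := hz.2.1
    have hz3 : 0 < ‖z.1 - z.2‖ := norm_sub_pos_iff.2 hz.2.2
    refine ne_of_gt ?_
    rw [choquardIntegrand, max_eq_left hz1.le, max_eq_left hz2.le]
    positivity
  have hA : 0 ≤ ∫ x, ‖gradient φ x‖ ^ 2 := integral_nonneg fun x => sq_nonneg _
  exact (criticalLevel_le hN hp (by positivity) φ hB (rpow_div_rpow_inv hA hB hp).ge).1

/-- Every level above `m_*` is detected by a test function in `Ω`: a minimizing element of the
critical Nehari manifold is approximated by a test function, which is then concentrated at a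
point of `Ω`. The term `lam ∫ φ²` scales with a higher power of the concentration parameter than
the Dirichlet integral, hence becomes negligible. -/
lemma exists_testFunction_quadForm_lt {μ lam M : ℝ} (hN : 3 ≤ N) (hμN : μ < N)
    (hΩ : (Ω : Set (Space N)).Nonempty) (hM : criticalLevel N μ < M) :
    ∃ k : ℝ, 0 < k ∧ (1 / 2 - 1 / (2 * criticalExponent N μ)) * k < M ∧ ∃ ψ : 𝓓(Ω, ℝ),
      quadForm lam ψ ^ criticalExponent N μ <
        nonlocalTerm (Ω : Set (Space N)) μ (criticalExponent N μ) ψ *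
          k ^ (criticalExponent N μ - 1) := by
  have hp := one_lt_criticalExponent hN hμN
  have hN3 : (3 : ℝ) ≤ N := by exact_mod_cast hN
  have hqdef : ((N : ℝ) - 2) * criticalExponent N μ = 2 * N - μ := by
    rw [criticalExponent]; exact mul_div_cancel₀ _ (by linarith)
  set q := criticalExponent N μ with hq
  have hc := half_sub_pos hp
  obtain ⟨_, ⟨u, hu, rfl⟩, huM⟩ :=
    exists_lt_of_csInf_lt ((criticalNehari_nonempty hN hμN).image _) hM
  rw [criticalEnergy_of_mem hu, ← hq, ← lt_div_iff₀' hc] at huM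
  set a := ∫ x, ‖u.grad x‖ ^ 2 with ha
  have ha0 : 0 < a := by
    refine lt_of_le_of_ne (integral_nonneg fun x => sq_nonneg _) fun h => hu.1 ?_
    simpa using (u.isTestLimit hN).ae_eq_zero hN (by simpa using h.symm)
  obtain ⟨k, hak, hkM⟩ := exists_between huM
  have hk : 0 < k := ha0.trans hak
  refine ⟨k, hk, (lt_div_iff₀' hc).1 hkM, ?_⟩
  -- Otherwise the reverse inequality would extend to `u`, for which both integrals equal `a < k`.
  obtain ⟨φ, hφ⟩ : ∃ φ : 𝓓((⊤ : Opens (Space N)), ℝ),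
      (∫ x, ‖gradient φ x‖ ^ 2) ^ q < nonlocalTerm Set.univ μ q φ * k ^ (q - 1) := by
    by_contra! hcon
    have h1 := (u.isTestLimit hN).mul_nonlocalTerm_le (p := q) (by omega) hμN (by linarith)
      (Real.rpow_nonneg hk.le (q - 1)) zero_le_one (fun φ => by
        rw [mul_comm, mul_one]; simpa using hcon φ)
    have hua : nonlocalTerm Set.univ μ q u.toFun = a := hu.2.symm
    simp only [Opens.coe_top, Measure.restrict_univ, mul_one, hua, ← ha] at h1
    have h2 : a ^ q = a ^ (q - 1) * a := by
      rw [← Real.rpow_add_one' ha0.le (by linarith)]; congr 1; ring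
    rw [h2] at h1
    exact (Real.rpow_lt_rpow ha0.le hak (by linarith)).not_ge (le_of_mul_le_mul_right h1 ha0)
  obtain ⟨x₀, hx₀⟩ := hΩ
  have hlim : Tendsto (fun δ : ℝ =>
      ((∫ x, ‖gradient φ x‖ ^ 2) + lam * δ ^ 2 * ∫ x, φ x ^ 2) ^ q) (𝓝[>] 0)
      (𝓝 ((∫ x, ‖gradient φ x‖ ^ 2) ^ q)) := by
    have hcont : Continuous fun δ : ℝ =>
        ((∫ x, ‖gradient φ x‖ ^ 2) + lam * δ ^ 2 * ∫ x, φ x ^ 2) ^ q :=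
      Continuous.rpow_const (by fun_prop) fun _ => Or.inr (by linarith)
    simpa using hcont.continuousWithinAt (x := 0) (s := Set.Ioi 0) |>.tendsto
  have hB : 0 < nonlocalTerm Set.univ μ q φ := by
    refine lt_of_le_of_ne (nonlocalTerm_nonneg _ _ _ _) fun h => ?_
    rw [← h, zero_mul] at hφ
    exact hφ.not_ge (Real.rpow_nonneg (integral_nonneg fun x => sq_nonneg _) _)
  have hA : 0 < ∫ x, ‖gradient φ x‖ ^ 2 :=
    integral_norm_gradient_sq_pos (Ω := ⊤) hN hp (φ := φ) (by simpa using hB)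
  have hpos : ∀ᶠ δ in 𝓝[>] (0 : ℝ),
      0 < (∫ x, ‖gradient φ x‖ ^ 2) + lam * δ ^ 2 * ∫ x, φ x ^ 2 := by
    have hcont : Continuous fun δ : ℝ =>
        (∫ x, ‖gradient φ x‖ ^ 2) + lam * δ ^ 2 * ∫ x, φ x ^ 2 := by fun_prop
    refine (hcont.continuousWithinAt (x := 0) (s := Set.Ioi 0)).eventually_const_lt ?_
    simpa using hA
  -- `quadForm` and the nonlocal term pick up the powers `δ ^ (N - 2)` and `δ ^ (2 * N - μ)`,
  -- which match because `(N - 2) * q = 2 * N - μ`.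
  obtain ⟨δ, hδ, ⟨ψ, hψ⟩, hδ0, hδpos⟩ := ((hlim.eventually_lt_const hφ).and
    ((eventually_exists_concentrated φ hx₀).and (eventually_mem_nhdsWithin.and hpos))).exists
  refine ⟨ψ, ?_⟩
  have hδ0 : 0 < δ := hδ0
  rw [quadForm_concentrated hδ0 hψ, nonlocalTerm_concentrated hδ0 hψ (by linarith),
    Real.mul_rpow (by positivity) hδpos.le, ← Real.rpow_mul hδ0.le, hqdef,
    mul_assoc (δ ^ (2 * (N : ℝ) - μ)) (nonlocalTerm _ _ _ _)]
  exact mul_lt_mul_of_pos_left hδ (Real.rpow_pos_of_pos hδ0 _)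

/-- The upper bound `limsup m_ε ≤ m_*`. -/
lemma eventually_groundLevel_lt {μ lam M : ℝ} (hN : 3 ≤ N) (hμN : μ < N) (hlam : 0 ≤ lam)
    (hΩ : (Ω : Set (Space N)).Nonempty) (hM : criticalLevel N μ < M) :
    ∀ᶠ p in 𝓝[<] criticalExponent N μ,
      (nehari Ω lam μ p).Nonempty ∧ groundLevel Ω lam μ p < M := by
  have hp := one_lt_criticalExponent hN hμN
  obtain ⟨k, hk, hkM, ψ, hψ⟩ :=
    exists_testFunction_quadForm_lt (Ω := Ω) (lam := lam) hN hμN hΩ hM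
  set q := criticalExponent N μ with hq
  have hQ0 : 0 ≤ quadForm lam ψ :=
    add_nonneg (integral_nonneg fun x => sq_nonneg _)
      (mul_nonneg hlam (integral_nonneg fun x => sq_nonneg _))
  have hB : 0 < nonlocalTerm (Ω : Set (Space N)) μ q ψ := by
    refine lt_of_le_of_ne (nonlocalTerm_nonneg _ _ _ _) fun h => ?_
    rw [← h, zero_mul] at hψ
    exact hψ.not_ge (Real.rpow_nonneg hQ0 _)
  have hid : Tendsto (fun p : ℝ => p) (𝓝[<] q) (𝓝 q) := nhdsWithin_le_nhds
  have hBlim := tendsto_nonlocalTerm_exponent (by omega) hμN (by linarith) ψ (q := q)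
  have hL : Tendsto (fun p : ℝ => quadForm lam ψ ^ p) (𝓝[<] q) (𝓝 (quadForm lam ψ ^ q)) :=
    tendsto_const_nhds.rpow hid (Or.inr (by linarith))
  have hR : Tendsto (fun p : ℝ => nonlocalTerm (Ω : Set (Space N)) μ p ψ * k ^ (p - 1)) (𝓝[<] q)
      (𝓝 (nonlocalTerm (Ω : Set (Space N)) μ q ψ * k ^ (q - 1))) :=
    hBlim.mul (tendsto_const_nhds.rpow (hid.sub_const 1) (Or.inl hk.ne'))
  filter_upwards [hL.eventually_lt hR hψ, hBlim.eventually_const_lt hB,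
    hid.eventually_const_lt hp, self_mem_nhdsWithin] with p h1 h2 h3 h4
  obtain ⟨hne, hle⟩ := groundLevel_le hN hlam h3 hk.le ψ h2 h1.le
  refine ⟨hne, hle.trans_lt (lt_of_le_of_lt ?_ hkM)⟩
  have h4 : p < q := h4
  gcongr

/-- The lower bound for `m_ε` obtained from an inequality for the exponent `q` on test functions by
Hölder's inequality on the bounded set `Ω`. Here `V` bounds the total mass of
`|x - y|^{-μ} dx dy` on `Ω × Ω`. -/
lemma le_groundLevel {μ lam p q k V : ℝ} (hN : 3 ≤ N) (hμN : μ < N) (hlam : 0 ≤ lam)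
    (hΩ : Bornology.IsBounded (Ω : Set (Space N))) (hp : 1 < p) (hpq : p < q) (hk : 0 ≤ k)
    (hV0 : 0 < V)
    (hV : ∫ z in (Ω : Set (Space N)) ×ˢ (Ω : Set (Space N)), 1 / ‖z.1 - z.2‖ ^ μ ≤ V)
    (h : ∀ φ : 𝓓(Ω, ℝ), nonlocalTerm (Ω : Set (Space N)) μ q φ * k ^ (q - 1) ≤
      (∫ x, ‖gradient φ x‖ ^ 2) ^ q)
    (hne : (nehari Ω lam μ p).Nonempty) :
    (1 / 2 - 1 / (2 * p)) *
      (k ^ ((q - 1) * (p / q)) / V ^ (1 - p / q)) ^ (1 / (p - 1)) ≤ groundLevel Ω lam μ p := by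
  have hp0 : 0 < p := by linarith
  have hq0 : 0 < q := by linarith
  have hθ0 : 0 < p / q := div_pos hp0 hq0
  have hθ1 : p / q < 1 := (div_lt_one hq0).2 hpq
  have hVθ : 0 < V ^ (1 - p / q) := Real.rpow_pos_of_pos hV0 _
  refine le_csInf (hne.image _) ?_
  rintro _ ⟨u, hu, rfl⟩
  rw [energy_of_mem_nehari hu]
  refine mul_le_mul_of_nonneg_left ?_ (half_sub_pos hp).le
  have htest : ∀ φ : 𝓓(Ω, ℝ),
      k ^ ((q - 1) * (p / q)) * nonlocalTerm (Ω : Set (Space N)) μ p φ ≤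
      (∫ x in (Ω : Set (Space N)), ‖gradient φ x‖ ^ 2) ^ p * V ^ (1 - p / q) := fun φ => by
    have hA : 0 ≤ ∫ x, ‖gradient φ x‖ ^ 2 := integral_nonneg fun x => sq_nonneg _
    have hB := nonlocalTerm_nonneg (Ω : Set (Space N)) μ q φ
    have h1 := nonlocalTerm_le_rpow_mul_rpow (by omega) hμN hq0 hθ0 hθ1 hΩ φ
    rw [div_mul_cancel₀ _ hq0.ne'] at h1
    have h2 := Real.rpow_le_rpow (by positivity) (h φ) hθ0.le
    rw [Real.mul_rpow hB (by positivity), ← Real.rpow_mul hk, ← Real.rpow_mul hA,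
      mul_div_cancel₀ _ hq0.ne'] at h2
    have h3 : nonlocalTerm (Ω : Set (Space N)) μ p φ ≤
        nonlocalTerm (Ω : Set (Space N)) μ q φ ^ (p / q) * V ^ (1 - p / q) :=
      h1.trans (mul_le_mul_of_nonneg_left (Real.rpow_le_rpow
        (integral_nonneg fun z => by positivity) hV (by linarith)) (by positivity))
    rw [setIntegral_norm_gradient_sq]
    calc k ^ ((q - 1) * (p / q)) * nonlocalTerm (Ω : Set (Space N)) μ p φ
        ≤ k ^ ((q - 1) * (p / q)) *
          (nonlocalTerm (Ω : Set (Space N)) μ q φ ^ (p / q) * V ^ (1 - p / q)) := by gcongr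
      _ = nonlocalTerm (Ω : Set (Space N)) μ q φ ^ (p / q) * k ^ ((q - 1) * (p / q)) *
          V ^ (1 - p / q) := by ring
      _ ≤ _ := by gcongr
  have hclosed := u.isTestLimit.mul_nonlocalTerm_le (by omega) hμN hp0
    (Real.rpow_nonneg hk _) hVθ.le htest
  have hnehari := hu.2
  rw [u.integral_add, sub_eq_zero] at hnehari
  rw [← hnehari] at hclosed
  have hL : 0 ≤ lam * ∫ x in (Ω : Set (Space N)), u.toFun x ^ 2 :=
    mul_nonneg hlam (integral_nonneg fun x => sq_nonneg _)
  have hD : 0 < ∫ x in (Ω : Set (Space N)), ‖u.grad x‖ ^ 2 :=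
    lt_of_le_of_ne (integral_nonneg fun x => sq_nonneg _)
      fun h0 => hu.1 (u.isTestLimit.ae_eq_zero hN h0.symm)
  set D := ∫ x in (Ω : Set (Space N)), ‖u.grad x‖ ^ 2 with hDdef
  set Q := D + lam * ∫ x in (Ω : Set (Space N)), u.toFun x ^ 2 with hQdef
  have hDQ : D ≤ Q := le_add_of_nonneg_right hL
  have hQ : 0 < Q := hD.trans_le hDQ
  have hp1 : 0 < p - 1 := by linarith
  rw [← Real.rpow_le_rpow_iff (by positivity) hQ.le hp1, ← Real.rpow_mul (by positivity),
    one_div_mul_cancel hp1.ne', Real.rpow_one, div_le_iff₀ hVθ]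
  refine le_of_mul_le_mul_right (hclosed.trans ?_) hQ
  calc D ^ p * V ^ (1 - p / q) ≤ Q ^ p * V ^ (1 - p / q) := by gcongr
    _ = Q ^ (p - 1) * V ^ (1 - p / q) * Q := by
      rw [Real.rpow_sub_one hQ.ne']; field_simp

lemma tendsto_lower_bound {q k V : ℝ} (hq : 1 < q) (hk : 0 ≤ k) (hV0 : 0 < V) :
    Tendsto (fun p : ℝ => (1 / 2 - 1 / (2 * p)) *
      (k ^ ((q - 1) * (p / q)) / V ^ (1 - p / q)) ^ (1 / (p - 1))) (𝓝[<] q)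
      (𝓝 ((1 / 2 - 1 / (2 * q)) * k)) := by
  have hq0 : q ≠ 0 := by linarith
  have hq1 : 0 < q - 1 := by linarith
  have hid : Tendsto (fun p : ℝ => p) (𝓝[<] q) (𝓝 q) := nhdsWithin_le_nhds
  have hdiv : Tendsto (fun p : ℝ => p / q) (𝓝[<] q) (𝓝 1) := by
    simpa [div_self hq0] using hid.div_const q
  have h1 : Tendsto (fun p : ℝ => k ^ ((q - 1) * (p / q))) (𝓝[<] q) (𝓝 (k ^ ((q - 1) * 1))) :=
    tendsto_const_nhds.rpow (hdiv.const_mul (q - 1)) (Or.inr (by linarith))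
  have h2 : Tendsto (fun p : ℝ => V ^ (1 - p / q)) (𝓝[<] q) (𝓝 (V ^ ((1 : ℝ) - 1))) :=
    tendsto_const_nhds.rpow (hdiv.const_sub 1) (Or.inl hV0.ne')
  have h3 : Tendsto (fun p : ℝ => 1 / (p - 1)) (𝓝[<] q) (𝓝 (1 / (q - 1))) :=
    tendsto_const_nhds.div (hid.sub_const 1) hq1.ne'
  have h4 := (h1.div h2 (Real.rpow_pos_of_pos hV0 _).ne').rpow h3 (Or.inr (by positivity))
  have h5 : Tendsto (fun p : ℝ => 1 / 2 - 1 / (2 * p)) (𝓝[<] q) (𝓝 (1 / 2 - 1 / (2 * q))) :=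
    tendsto_const_nhds.sub (tendsto_const_nhds.div (hid.const_mul 2) (by positivity))
  have h6 := h5.mul h4
  rwa [sub_self, Real.rpow_zero, div_one, mul_one, ← Real.rpow_mul hk,
    mul_one_div_cancel hq1.ne', Real.rpow_one] at h6

lemma tendsto_groundLevel {μ lam : ℝ} (hN : 3 ≤ N) (hμN : μ < N) (hlam : 0 ≤ lam)
    (hΩ : (Ω : Set (Space N)).Nonempty) (hΩb : Bornology.IsBounded (Ω : Set (Space N))) :
    Tendsto (groundLevel Ω lam μ) (𝓝[<] criticalExponent N μ) (𝓝 (criticalLevel N μ)) := by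
  have hp := one_lt_criticalExponent hN hμN
  have hc := half_sub_pos hp
  refine tendsto_order.2 ⟨fun m hm => ?_, fun M hM =>
    (eventually_groundLevel_lt hN hμN hlam hΩ hM).mono fun p h => h.2⟩
  have hk : 0 ≤ criticalLevel N μ / (1 / 2 - 1 / (2 * criticalExponent N μ)) :=
    div_nonneg (criticalLevel_nonneg hp) hc.le
  have hV : 0 ≤ ∫ z in (Ω : Set (Space N)) ×ˢ (Ω : Set (Space N)), 1 / ‖z.1 - z.2‖ ^ μ :=
    integral_nonneg fun z => by positivity
  -- One is added to the mass of the kernel only to have a positive base for the powers.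
  have hV0 := add_pos_of_nonneg_of_pos hV one_pos
  have hlim := tendsto_lower_bound hp hk hV0
  rw [mul_div_cancel₀ _ hc.ne'] at hlim
  filter_upwards [hlim.eventually_const_lt hm, self_mem_nhdsWithin,
    eventually_nhdsWithin_of_eventually_nhds (lt_mem_nhds hp),
    eventually_groundLevel_lt hN hμN hlam hΩ (lt_add_one (criticalLevel N μ))] with p h1 h2 h3 h4
  exact h1.trans_le (le_groundLevel hN hμN hlam hΩb h3 h2 hk hV0 (le_add_of_nonneg_right one_pos.le)
    (nonlocalTerm_mul_level_le hN hμN) h4.1)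

end Choquard

theorem proposition4p5 (N : ℕ) (hN : 3 < N) (μ : ℝ) (hμ0 : 0 < μ) (hμN : μ < N)
    (lam : ℝ) (hlam : 0 ≤ lam) (Ω : Opens (Choquard.Space N))
    (hΩc : IsConnected (Ω : Set (Choquard.Space N)))
    (hΩb : Bornology.IsBounded (Ω : Set (Choquard.Space N))) :
    Tendsto (fun ε : ℝ => Choquard.groundLevel Ω lam μ (Choquard.criticalExponent N μ - ε))
      (𝓝[>] 0) (𝓝 (Choquard.criticalLevel N μ)) := by
  refine (Choquard.tendsto_groundLevel hN.le hμN hlam hΩc.nonempty hΩb).comp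
    (tendsto_nhdsWithin_iff.2 ⟨?_, ?_⟩)
  · have h : Tendsto (fun ε : ℝ => Choquard.criticalExponent N μ - ε) (𝓝 0)
        (𝓝 (Choquard.criticalExponent N μ - 0)) := tendsto_id.const_sub _
    rw [sub_zero] at h
    exact h.mono_left nhdsWithin_le_nhds
  · filter_upwards [self_mem_nhdsWithin] with ε hε
    exact sub_lt_self _ (Set.mem_Ioi.1 hε)
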